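/- There is an absolute constant $C>0$ with the following property. Let $n\ge 1$, let $\Omega\subset\mathbf R^n$ be an open set, and let $V:\mathbf R^n\to\mathbf R$ be bounded and continuous with $V(x)\ge 0$ for all $x\in\mathbf R^n$ and $V(x)>0$ for all $x\in\Omega$. All functions are real-valued, and $\|\cdot\|$ and $(\cdot,\cdot)$ denote the norm and inner product of $L^2(\mathbf R^n)$. Let $(u_0,u_1)\in H^1(\mathbf R^n)\times L^2(\mathbf R^n)$ with $\operatorname{supp}u_1\subset\Omega$ and $$J_0^2:=\int_\Omega\frac{|u_1(x)|^2}{V(x)}\,dx<+\infty ,\qquad J_0\ge 0.$$ Let $u\in C([0,\infty);H^1(\mathbf R^n))\cap C^1([0,\infty);L^2(\mathbf R^n))$ be the (unique) weak solution of the Cauchy problem $$u_{tt}-\Delta u+V(x)u=0\quad (t>0,\ x\in\mathbf R^n),\qquad u(0,x)=u_0(x),\quad u_t(0,x)=u_1(x),$$ that is, $u(0)=u_0$, $u_t(0)=u_1$, and for every $\varphi\in H^1(\mathbf R^n)$ and every $t\ge0$ $$\frac{d}{dt}(u_t(t),\varphi)+(\nabla u(t),\nabla\varphi)+\int_{\mathbf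 R^n}V(x)\,u(t,x)\,\varphi(x)\,dx=0 .$$ Then $$\|u(t,\cdot)\|\le C\,(\|u_0\|+J_0)\qquad\text{for all } t\ge 0 .$$ -/

import Mathlib

open MeasureTheory Set Filter Topology
open scoped ContDiff ENNReal BoundedContinuousFunction InnerProductSpace

namespace WaveEq

/-- Euclidean space `ℝⁿ`. -/
abbrev Rn (n : ℕ) : Type := EuclideanSpace ℝ (Fin n)

/-- The real Hilbert space `L²(ℝⁿ)`. -/
abbrev L2 (n : ℕ) : Type := Lp ℝ 2 (volume : Measure (Rn n))

/-- The real Hilbert space `L²(ℝⁿ; ℝⁿ)` of square integrable vector fields. -/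
abbrev L2Vec (n : ℕ) : Type := Lp (Rn n) 2 (volume : Measure (Rn n))

/-- `G` is the weak gradient of `f`: for every test function `φ ∈ C_c^∞(ℝⁿ)` and every `i`,
`∫ f ∂ᵢφ dx = - ∫ Gᵢ φ dx`. -/
def IsWeakGradient {n : ℕ} (f : L2 n) (G : L2Vec n) : Prop :=
  ∀ φ : Rn n → ℝ, ContDiff ℝ ∞ φ → HasCompactSupport φ → ∀ i : Fin n,
    ∫ x, f x * fderiv ℝ φ x (EuclideanSpace.single i 1) = -∫ x, G x i * φ x

theorem integrable_mul_partial {n : ℕ} (f : L2 n) {φ : Rn n → ℝ} (hφ : ContDiff ℝ ∞ φ)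
    (hc : HasCompactSupport φ) (v : Rn n) :
    Integrable (fun x => f x * fderiv ℝ φ x v) := by
  have h1 : Continuous fun x => fderiv ℝ φ x v :=
    (hφ.continuous_fderiv (by simp)).clm_apply continuous_const
  have h2 : HasCompactSupport fun x => fderiv ℝ φ x v := hc.fderiv_apply ℝ v
  exact (Lp.memLp f).integrable_mul (h1.memLp_of_hasCompactSupport (p := 2) h2)

theorem integrable_coord_mul {n : ℕ} (G : L2Vec n) {φ : Rn n → ℝ} (hφ : ContDiff ℝ ∞ φ)
    (hc : HasCompactSupport φ) (i : Fin n) :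
    Integrable (fun x => G x i * φ x) := by
  have h := (EuclideanSpace.proj i : Rn n →L[ℝ] ℝ).comp_memLp' (Lp.memLp G)
  exact h.integrable_mul (hφ.continuous.memLp_of_hasCompactSupport (p := 2) hc)

theorem IsWeakGradient.zero {n : ℕ} : IsWeakGradient (0 : L2 n) 0 := by
  intro φ _ _ i
  have h1 : (fun x => (0 : L2 n) x * fderiv ℝ φ x (EuclideanSpace.single i 1))
      =ᵐ[volume] fun _ => 0 := by
    filter_upwards [Lp.coeFn_zero ℝ 2 (volume : Measure (Rn n))] with x hx
    rw [hx]
    simp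
  have h2 : (fun x => (0 : L2Vec n) x i * φ x) =ᵐ[volume] fun _ => 0 := by
    filter_upwards [Lp.coeFn_zero (Rn n) 2 (volume : Measure (Rn n))] with x hx
    rw [hx]
    simp
  rw [integral_congr_ae h1, integral_congr_ae h2]
  simp

theorem IsWeakGradient.add {n : ℕ} {f g : L2 n} {F G : L2Vec n} (hf : IsWeakGradient f F)
    (hg : IsWeakGradient g G) : IsWeakGradient (f + g) (F + G) := by
  intro φ hφ hc i
  have h1 : (fun x => (f + g) x * fderiv ℝ φ x (EuclideanSpace.single i 1)) =ᵐ[volume]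
      fun x => f x * fderiv ℝ φ x (EuclideanSpace.single i 1) +
        g x * fderiv ℝ φ x (EuclideanSpace.single i 1) := by
    filter_upwards [Lp.coeFn_add f g] with x hx
    rw [hx]
    simp [add_mul]
  have h2 : (fun x => (F + G) x i * φ x) =ᵐ[volume] fun x => F x i * φ x + G x i * φ x := by
    filter_upwards [Lp.coeFn_add F G] with x hx
    rw [hx]
    simp [add_mul]
  rw [integral_congr_ae h1, integral_congr_ae h2,
    integral_add (integrable_mul_partial f hφ hc _) (integrable_mul_partial g hφ hc _),
    integral_add (integrable_coord_mul F hφ hc i) (integrable_coord_mul G hφ hc i),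
    hf φ hφ hc i, hg φ hφ hc i]
  ring

theorem IsWeakGradient.smul {n : ℕ} {f : L2 n} {F : L2Vec n} (c : ℝ)
    (hf : IsWeakGradient f F) : IsWeakGradient (c • f) (c • F) := by
  intro φ hφ hc i
  have h1 : (fun x => (c • f) x * fderiv ℝ φ x (EuclideanSpace.single i 1)) =ᵐ[volume]
      fun x => c * (f x * fderiv ℝ φ x (EuclideanSpace.single i 1)) := by
    filter_upwards [Lp.coeFn_smul c f] with x hx
    rw [hx]
    simp [mul_assoc]
  have h2 : (fun x => (c • F) x i * φ x) =ᵐ[volume] fun x => c * (F x i * φ x) := by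
    filter_upwards [Lp.coeFn_smul c F] with x hx
    rw [hx]
    simp [mul_assoc]
  rw [integral_congr_ae h1, integral_congr_ae h2, integral_const_mul, integral_const_mul,
    hf φ hφ hc i]
  ring

/-- The Sobolev space `H¹(ℝⁿ)`: the functions `f ∈ L²(ℝⁿ)` that have a weak gradient
`∇f ∈ L²(ℝⁿ; ℝⁿ)`, realized as the space of pairs `(f, ∇f)` (the weak gradient is determined by
`f`), with the Hilbert norm `‖f‖²_{H¹} = ‖f‖² + ‖∇f‖²` of the `ℓ²`-product. -/
def H1 (n : ℕ) : Submodule ℝ (WithLp 2 (L2 n × L2Vec n)) where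
  carrier := {p | IsWeakGradient p.fst p.snd}
  add_mem' := fun hp hq => hp.add hq
  zero_mem' := IsWeakGradient.zero
  smul_mem' := fun c _ hp => hp.smul c

/-- The `L²`-function underlying an element of `H¹(ℝⁿ)`. -/
def toL2 {n : ℕ} (f : H1 n) : L2 n := f.1.fst

/-- The weak gradient of an element of `H¹(ℝⁿ)`. -/
def weakGrad {n : ℕ} (f : H1 n) : L2Vec n := f.1.snd

/-- The (closed) support of the class `f ∈ L²(ℝⁿ)`: the points no neighbourhood of which is a
set where `f` vanishes almost everywhere. -/
def essSupport {n : ℕ} (f : L2 n) : Set (Rn n) :=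
  {x | ∀ U ∈ 𝓝 x, ¬ ∀ᵐ y ∂(volume.restrict U), f y = 0}

/-- `u ∈ C([0,∞); H¹(ℝⁿ)) ∩ C¹([0,∞); L²(ℝⁿ))` is a weak solution of
`u_tt - Δu + V u = 0`, `u(0) = u₀`, `u_t(0) = u₁`: there is a time derivative
`u_t ∈ C([0,∞); L²(ℝⁿ))` (one-sided at `t = 0`) and, for every `φ ∈ H¹(ℝⁿ)` and `t ≥ 0`,
`d/dt (u_t, φ) + (∇u, ∇φ) + ∫ V u φ dx = 0`. Only the values `u t` with `t ≥ 0` matter. -/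
def IsWeakSolution {n : ℕ} (V : Rn n →ᵇ ℝ) (u₀ : H1 n) (u₁ : L2 n) (u : ℝ → H1 n) : Prop :=
  ContinuousOn u (Ici 0) ∧ u 0 = u₀ ∧
  ∃ ut : ℝ → L2 n, ContinuousOn ut (Ici 0) ∧ ut 0 = u₁ ∧
    (∀ t : ℝ, 0 ≤ t → HasDerivWithinAt (fun s => toL2 (u s)) (ut t) (Ici 0) t) ∧
    ∀ φ : H1 n, ∀ t : ℝ, 0 ≤ t →
      HasDerivWithinAt (fun s => ⟪ut s, toL2 φ⟫_ℝ)
        (-(⟪weakGrad (u t), weakGrad φ⟫_ℝ + ∫ x, V x * toL2 (u t) x * toL2 φ x)) (Ici 0) t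

end WaveEq

namespace WaveEq

variable {n : ℕ}

/-! The time integral w(t) = ∫₀ᵗ u solves, weakly, w_tt - Δw + V w = u₁ with w(0) = 0 and w_t(0) =
u₀. Its kinetic energy is ‖u‖², and since u₁ does not depend on time, the work of the source is the
exact derivative of (u₁, w). Hence ‖u‖² + ‖∇w‖² + (V w, w) = ‖u₀‖² + 2 (u₁, w), which is
`IsWeakSolution.exists_energy_identity`. The weighted Young inequality 2 u₁ w ≤ u₁²/V + V w²
(`two_mul_inner_le`) lets the potential energy absorb the source, leaving ‖u‖² ≤ ‖u₀‖² + J₀², so C =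
1 suffices in every dimension. -/

theorem memLp_mul_bounded (V : Rn n →ᵇ ℝ) (f : L2 n) :
    MemLp (fun x => V x * f x) 2 (volume : Measure (Rn n)) :=
  (Lp.memLp f).of_le_mul (c := ‖V‖)
    (V.continuous.aestronglyMeasurable.mul (Lp.aestronglyMeasurable f))
    (Eventually.of_forall fun x => by
      rw [norm_mul]
      exact mul_le_mul_of_nonneg_right (V.norm_coe_le_norm x) (norm_nonneg _))

/-- Multiplication by a bounded continuous function, as a bounded operator on `L²(ℝⁿ)`. -/
noncomputable def mulOp (V : Rn n →ᵇ ℝ) : L2 n →L[ℝ] L2 n :=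
  LinearMap.mkContinuous
    { toFun := fun f => (memLp_mul_bounded V f).toLp
      map_add' := fun f g => by
        rw [← MemLp.toLp_add]
        refine MemLp.toLp_congr _ _ ?_
        filter_upwards [Lp.coeFn_add f g] with x hx
        simp only [hx, Pi.add_apply]
        ring
      map_smul' := fun c f => by
        rw [RingHom.id_apply, ← MemLp.toLp_const_smul]
        refine MemLp.toLp_congr _ _ ?_
        filter_upwards [Lp.coeFn_smul c f] with x hx
        simp only [hx, Pi.smul_apply, smul_eq_mul]
        ring }
    ‖V‖ (fun f => by
      refine Lp.norm_le_mul_norm_of_ae_le_mul ?_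
      filter_upwards [(memLp_mul_bounded V f).coeFn_toLp] with x hx
      change ‖(memLp_mul_bounded V f).toLp _ x‖ ≤ _
      rw [hx, norm_mul]
      exact mul_le_mul_of_nonneg_right (V.norm_coe_le_norm x) (norm_nonneg _))

theorem coeFn_mulOp (V : Rn n →ᵇ ℝ) (f : L2 n) :
    mulOp V f =ᵐ[volume] fun x => V x * f x :=
  (memLp_mul_bounded V f).coeFn_toLp

theorem inner_mulOp (V : Rn n →ᵇ ℝ) (f g : L2 n) :
    ⟪mulOp V f, g⟫_ℝ = ∫ x, V x * f x * g x := by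
  rw [L2.inner_def]
  refine integral_congr_ae ?_
  filter_upwards [coeFn_mulOp V f] with x hx
  simp only [hx, RCLike.inner_apply, conj_trivial]
  ring

theorem inner_mulOp_comm (V : Rn n →ᵇ ℝ) (f g : L2 n) :
    ⟪mulOp V f, g⟫_ℝ = ⟪mulOp V g, f⟫_ℝ := by
  rw [inner_mulOp, inner_mulOp]
  exact integral_congr_ae (Eventually.of_forall fun x => by ring)

/-- By second countability of ℝⁿ, a set that is null near each of its points is null. -/
theorem ae_eq_zero_of_notMem_essSupport (f : L2 n) :
    ∀ᵐ x ∂(volume : Measure (Rn n)), x ∉ essSupport f → f x = 0 := by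
  have hnull : (volume : Measure (Rn n)) ({x | f x ≠ 0} ∩ (essSupport f)ᶜ) = 0 := by
    refine measure_null_of_locally_null _ fun x hx => ?_
    have hx' : ¬ ∀ U ∈ 𝓝 x, ¬ ∀ᵐ y ∂(volume.restrict U), f y = 0 := hx.2
    push Not at hx'
    obtain ⟨U, hU, hz⟩ := hx'
    obtain ⟨O, hOU, hO, hxO⟩ := mem_nhds_iff.1 hU
    refine ⟨_, inter_mem_nhdsWithin _ (hO.mem_nhds hxO), ?_⟩
    have hz' := (ae_restrict_iff' hO.measurableSet).1
      (ae_mono (Measure.restrict_mono hOU le_rfl) hz)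
    refine measure_mono_null (fun y hy => ?_) hz'
    exact fun h => hy.1.1 (h hy.2)
  have : ∀ᵐ x ∂(volume : Measure (Rn n)), x ∉ {x | f x ≠ 0} ∩ (essSupport f)ᶜ :=
    measure_eq_zero_iff_ae_notMem.1 hnull
  filter_upwards [this] with x hx hxs
  by_contra h
  exact hx ⟨h, hxs⟩

theorem two_mul_inner_le (V : Rn n →ᵇ ℝ) {Ω : Set (Rn n)} (hΩ : IsOpen Ω)
    (hpos : ∀ x ∈ Ω, 0 < V x) (hnn : ∀ x, 0 ≤ V x) {g : L2 n} (hg : essSupport g ⊆ Ω)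
    (hint : IntegrableOn (fun x => |g x| ^ 2 / V x) Ω) (w : L2 n) :
    2 * ⟪g, w⟫_ℝ ≤ (∫ x in Ω, |g x| ^ 2 / V x) + ⟪mulOp V w, w⟫_ℝ := by
  have hVw : Integrable (fun x => V x * w x * w x) (volume : Measure (Rn n)) :=
    (memLp_mul_bounded V w).integrable_mul (Lp.memLp w)
  have hgw : Integrable (fun x => g x * w x) (volume : Measure (Rn n)) :=
    (Lp.memLp g).integrable_mul (Lp.memLp w)
  have hgV := (integrable_indicator_iff hΩ.measurableSet).2 hint
  have hinner : ⟪g, w⟫_ℝ = ∫ x, g x * w x := by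
    rw [L2.inner_def]
    refine integral_congr_ae (Eventually.of_forall fun x => ?_)
    simp only [RCLike.inner_apply, conj_trivial]
    ring
  rw [hinner, inner_mulOp, ← integral_const_mul, ← integral_indicator hΩ.measurableSet,
    ← integral_add hgV hVw]
  refine integral_mono_ae (hgw.const_mul 2) (hgV.add hVw) ?_
  filter_upwards [ae_eq_zero_of_notMem_essSupport g] with x hx
  by_cases hxΩ : x ∈ Ω
  · have hV := hpos x hxΩ
    simp only [indicator_of_mem hxΩ, sq_abs]
    -- The gap in Young's inequality is a square divided by V, and V > 0 on Ω.
    have key : g x ^ 2 / V x + V x * w x * w x - 2 * (g x * w x)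
        = (g x - V x * w x) ^ 2 / V x := by
      field_simp
      ring
    have : 0 ≤ (g x - V x * w x) ^ 2 / V x := by positivity
    linarith
  · simp only [indicator_of_notMem hxΩ, hx fun h => hxΩ (hg h)]
    have := mul_nonneg (hnn x) (mul_self_nonneg (w x))
    simp only [zero_mul, mul_zero, zero_add]
    linarith

/-- A primitive on `[0, ∞)` of a function continuous there. -/
theorem exists_primitive {E : Type*} [NormedAddCommGroup E] [NormedSpace ℝ E] [CompleteSpace E]
    {f : ℝ → E} (hf : ContinuousOn f (Ici 0)) :
    ∃ F : ℝ → E, F 0 = 0 ∧ ∀ t, 0 ≤ t → HasDerivWithinAt F (f t) (Ici 0) t := by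
  -- Extending f by the constant f 0 to negative times gives a function continuous on all of ℝ, so
  -- the fundamental theorem of calculus also covers t = 0.
  have hc : Continuous fun s => f (max s 0) :=
    hf.comp_continuous (continuous_id.max continuous_const) fun s => le_max_right s 0
  refine ⟨fun t => ∫ s in (0 : ℝ)..t, f (max s 0), by simp, fun t ht => ?_⟩
  have := (hc.integral_hasStrictDerivAt 0 t).hasDerivAt.hasDerivWithinAt (s := Ici 0)
  rwa [max_eq_left ht] at this

theorem eq_of_hasDerivWithinAt_zero {f : ℝ → ℝ}
    (hf : ∀ t, 0 ≤ t → HasDerivWithinAt f 0 (Ici 0) t) {t : ℝ} (ht : 0 ≤ t) : f t = f 0 := by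
  refine constant_of_has_deriv_right_zero (a := 0) (b := t)
    (fun s hs => ((hf s hs.1).continuousWithinAt).mono Icc_subset_Ici_self)
    (fun s hs => (hf s hs.1).mono (Ici_subset_Ici.2 hs.1)) t ⟨ht, le_rfl⟩

/-- The time-integrated solution `w = ∫₀ᵗ u` satisfies an energy identity whose kinetic part is
`‖u‖²`. -/
theorem IsWeakSolution.exists_energy_identity {V : Rn n →ᵇ ℝ} {u₀ : H1 n} {u₁ : L2 n}
    {u : ℝ → H1 n} (hu : IsWeakSolution V u₀ u₁ u) :
    ∃ (w : ℝ → L2 n) (W : ℝ → L2Vec n), ∀ t, 0 ≤ t →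
      ‖toL2 (u t)‖ ^ 2 + ‖W t‖ ^ 2 + ⟪mulOp V (w t), w t⟫_ℝ =
        ‖toL2 u₀‖ ^ 2 + 2 * ⟪u₁, w t⟫_ℝ := by
  obtain ⟨hcont, h0, ut, -, hut0, hder, hweak⟩ := hu
  have hcL : ContinuousOn (fun t => toL2 (u t)) (Ici 0) := fun t ht => (hder t ht).continuousWithinAt
  have hcG : ContinuousOn (fun t => weakGrad (u t)) (Ici 0) :=
    (WithLp.prod_continuous_ofLp 2 _ _).snd.comp_continuousOn
      (continuous_subtype_val.comp_continuousOn hcont)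
  obtain ⟨w, hw0, hw⟩ := exists_primitive hcL
  -- W plays the role of ∇w. Only its time derivative ∇u and W(0) = 0 are used, so w need not be
  -- shown to lie in H¹.
  obtain ⟨W, hW0, hW⟩ := exists_primitive hcG
  have hMw : ∀ t, 0 ≤ t → HasDerivWithinAt (fun s => mulOp V (w s)) (mulOp V (toL2 (u t)))
      (Ici 0) t := fun t ht => (mulOp V).hasFDerivAt.comp_hasDerivWithinAt t (hw t ht)
  -- The weak equation integrated in time: by it, the left side has zero derivative for fixed φ. No
  -- derivative of `ut` remains.
  have hint : ∀ (φ : H1 n) (t : ℝ), 0 ≤ t →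
      ⟪ut t, toL2 φ⟫_ℝ + ⟪W t, weakGrad φ⟫_ℝ + ⟪mulOp V (w t), toL2 φ⟫_ℝ = ⟪u₁, toL2 φ⟫_ℝ := by
    intro φ t ht
    have := eq_of_hasDerivWithinAt_zero
      (f := fun s => ⟪ut s, toL2 φ⟫_ℝ + ⟪W s, weakGrad φ⟫_ℝ + ⟪mulOp V (w s), toL2 φ⟫_ℝ)
      (fun s hs => by
        refine (((hweak φ s hs).add ((hW s hs).inner ℝ (hasDerivWithinAt_const s _ (weakGrad φ)))).add
          ((hMw s hs).inner ℝ (hasDerivWithinAt_const s _ (toL2 φ)))).congr_deriv ?_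
        rw [← inner_mulOp]
        simp) ht
    simpa [hw0, hW0, hut0] using this
  refine ⟨w, W, fun t ht => ?_⟩
  have := eq_of_hasDerivWithinAt_zero
    (f := fun s => ⟪toL2 (u s), toL2 (u s)⟫_ℝ + ⟪W s, W s⟫_ℝ + ⟪mulOp V (w s), w s⟫_ℝ
      - 2 * ⟪u₁, w s⟫_ℝ)
    (fun s hs => by
      refine (((((hder s hs).inner ℝ (hder s hs)).add ((hW s hs).inner ℝ (hW s hs))).add
        ((hMw s hs).inner ℝ (hw s hs))).sub
        (((hasDerivWithinAt_const s _ u₁).inner ℝ (hw s hs)).const_mul 2)).congr_deriv ?_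
      -- With s frozen, φ = u(s) = w_t(s) is an admissible test function; twice this identity, with
      -- (V u, w) = (V w, u), says that the energy derivative is zero.
      have h := hint (u s) s hs
      rw [inner_mulOp_comm V (toL2 (u s)), inner_zero_left, add_zero,
        real_inner_comm (ut s) (toL2 (u s)), real_inner_comm (W s) (weakGrad (u s))]
      linarith) ht
  simp only [hw0, hW0, h0, inner_zero_right, real_inner_self_eq_norm_sq] at this
  norm_num at this
  linarith

end WaveEq

theorem theorem1p2 :
    ∃ C : ℝ, 0 < C ∧
      ∀ (n : ℕ), 1 ≤ n →
      ∀ (Ω : Set (WaveEq.Rn n)), IsOpen Ω →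
      ∀ (V : WaveEq.Rn n →ᵇ ℝ), (∀ x ∈ Ω, 0 < V x) → (∀ x, 0 ≤ V x) →
      ∀ (u₀ : WaveEq.H1 n) (u₁ : WaveEq.L2 n), WaveEq.essSupport u₁ ⊆ Ω →
        IntegrableOn (fun x => |u₁ x| ^ 2 / V x) Ω →
      ∀ (u : ℝ → WaveEq.H1 n), WaveEq.IsWeakSolution V u₀ u₁ u →
      ∀ t : ℝ, 0 ≤ t →
        ‖WaveEq.toL2 (u t)‖ ≤ C * (‖WaveEq.toL2 u₀‖ + Real.sqrt (∫ x in Ω, |u₁ x| ^ 2 / V x)) := by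
  refine ⟨1, one_pos, fun n _ Ω hΩ V hpos hnn u₀ u₁ hsupp hint u hu t ht => ?_⟩
  obtain ⟨w, W, h⟩ := hu.exists_energy_identity
  have hE := h t ht
  have hJ := WaveEq.two_mul_inner_le V hΩ hpos hnn hsupp hint (w t)
  have hJ0 : 0 ≤ ∫ x in Ω, |u₁ x| ^ 2 / V x :=
    integral_nonneg fun x => div_nonneg (sq_nonneg _) (hnn x)
  rw [one_mul]
  -- It suffices to compare squares: ‖u₀‖² + J₀² ≤ (‖u₀‖ + J₀)².
  refine abs_le_of_sq_le_sq' ?_ (by positivity) |>.2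
  nlinarith [Real.sq_sqrt hJ0, Real.sqrt_nonneg (∫ x in Ω, |u₁ x| ^ 2 / V x),
    norm_nonneg (WaveEq.toL2 u₀), sq_nonneg ‖W t‖,
    mul_nonneg (norm_nonneg (WaveEq.toL2 u₀)) (Real.sqrt_nonneg (∫ x in Ω, |u₁ x| ^ 2 / V x))]
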